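/- Let $n\ge 1$ be an integer. Write points of $\mathbb R^{n+1}$ as $(x,y)\in\mathbb R^n\times\mathbb R$. Let $\mathcal D_e$ (resp. $\mathcal S_e$) be the space of complex-valued functions $f$ on $\mathbb R^{n+1}$ that are smooth with compact support (resp. Schwartz) and satisfy $f(x,-y)=f(x,y)$. For such $f$ define its spherical mean $g=Rf$ on $\mathbb R^n\times\mathbb R^{n+1}$ by $$Rf(x,y)=\frac1{|S^n|}\int_{S^n} f(x+\|y\|\xi,\|y\|\eta)\,dS_n(\xi,\eta),$$ where $S^n$ is the unit sphere of $\mathbb R^{n+1}$ with surface measure $S_n$. The Fourier transform on $\mathbb R^d$ is $\hat\varphi(\xi)=(2\pi)^{-d/2}\int e^{-i\langle v,\xi\rangle}\varphi(v)\,dv$, and for the bounded continuous function $g$ the tempered distribution $\hat g$ is defined by $\langle\hat g,\varphi\rangle=\int g\,\hat\varphi$ for Schwartz functions $\varphi$. If $\hat g$ is a function, $Kg$ is defined by $\widehat{Kg}(\xi,\eta)=\sqrt{\|\eta\|^2-\|\xi\|^2}\,\|\eta\|^{n-1}\hat g(\xi,\eta)$ for $(\xi,\eta)\in\mathbb R^n\times\mathbb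 R^{n+1}$, the root being read as $0$ for $\|\eta\|<\|\xi\|$. Put $c_n=(2\pi)^{-n}|S^n|/2$. (1) Let $f\in\mathcal D_e$ with $\hat f(0,0)\ne0$ and $g=Rf$. Then $g\notin L^2(\mathbb R^n\times\mathbb R^{n+1})$, and $\hat g\notin L^2(\mathbb R^n\times\mathbb R^{n+1})$, that is, $\hat g$ is not represented by any $L^2$ function. In particular $g$ is not a Schwartz function. (2) By contrast, let $f\in\mathcal S_e$ and $g=Rf$. Then $\hat g$ is represented by an integrable function, $\widehat{Kg}\in L^p(\mathbb R^n\times\mathbb R^{n+1})$ for every $0<p\le\infty$, and the formula $f=c_nR^*Kg$ holds in the following distributional sense: for all $\varphi\in\mathcal S_e$ such that $\widehat{R\varphi}$ is represented by an integrable function, $$\int_{\mathbb R^{n+1}} f\varphi = c_n\int_{\mathbb R^n\times\mathbb R^{n+1}}\widehat{Kg}(\zeta)\,\widehat{R\varphi}(-\zeta)\,d\zeta ,$$ where the integral on the right converges absolutely. (The integral on the right is $\langle Kg,R\varphi\rangle$ written on the Fourier side, and $R^*$ is the transpose of $R$.) -/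

import Mathlib

open MeasureTheory Metric
open scoped SchwartzMap ContDiff ENNReal

noncomputable section

/-- `ℝⁿ × ℝ = ℝⁿ⁺¹` with the Euclidean norm; points `(x, y)` of the reflectivity domain. -/
abbrev ImageSpace (n : ℕ) : Type := WithLp 2 (EuclideanSpace ℝ (Fin n) × ℝ)

/-- `ℝⁿ × ℝⁿ⁺¹ = ℝ²ⁿ⁺¹` with the Euclidean norm; the domain of the data. -/
abbrev DataSpace (n : ℕ) : Type :=
  WithLp 2 (EuclideanSpace ℝ (Fin n) × EuclideanSpace ℝ (Fin (n + 1)))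

/-- `f(x, -y) = f(x, y)`. -/
def EvenInLast {n : ℕ} (f : ImageSpace n → ℂ) : Prop :=
  ∀ (x : EuclideanSpace ℝ (Fin n)) (y : ℝ), f (WithLp.toLp 2 (x, -y)) = f (WithLp.toLp 2 (x, y))

/-- The space `𝒟ₑ(ℝⁿ⁺¹)` of smooth compactly supported functions that are even in the last
variable. -/
def testFunctionsEven (n : ℕ) : Set (ImageSpace n → ℂ) :=
  {f | ContDiff ℝ ∞ f ∧ HasCompactSupport f ∧ EvenInLast f}

/-- The space `𝒮ₑ(ℝⁿ⁺¹)` of Schwartz functions that are even in the last variable. -/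
def schwartzEven (n : ℕ) : Set 𝓢(ImageSpace n, ℂ) :=
  {f | EvenInLast (f : ImageSpace n → ℂ)}

/-- The surface measure `Sₙ` on the unit sphere `Sⁿ` of `ℝⁿ⁺¹ = ℝⁿ × ℝ`. -/
def surfaceMeasure (n : ℕ) : Measure (sphere (0 : ImageSpace n) 1) :=
  (volume : Measure (ImageSpace n)).toSphere

/-- The spherical mean operator
`Rf(x, r) = |Sⁿ|⁻¹ ∫_{Sⁿ} f(x + rξ, rη) dSₙ(ξ, η)`, regarded as a function of
`(x, y) ∈ ℝⁿ × ℝⁿ⁺¹` that is radial in `y`, through `r = ‖y‖`. -/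
def sphericalMean {n : ℕ} (f : ImageSpace n → ℂ) (p : DataSpace n) : ℂ :=
  ⨍ σ : sphere (0 : ImageSpace n) 1,
    f (WithLp.toLp 2 (p.fst + ‖p.snd‖ • (σ : ImageSpace n).fst,
      ‖p.snd‖ * (σ : ImageSpace n).snd)) ∂(surfaceMeasure n)

/-- The Fourier transform `φ̂(ξ) = (2π)^{-d/2} ∫ e^{-i⟨v, ξ⟩} φ(v) dv` on a `d`-dimensional Euclidean
space. -/
def unitaryFourier {V : Type*} [NormedAddCommGroup V] [InnerProductSpace ℝ V]
    [FiniteDimensional ℝ V] [MeasurableSpace V] [BorelSpace V] (φ : V → ℂ) (ξ : V) : ℂ :=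
  (((2 * Real.pi) ^ (-(Module.finrank ℝ V : ℝ) / 2) : ℝ) : ℂ) *
    ∫ v, Complex.exp (-Complex.I * ((inner ℝ v ξ : ℝ) : ℂ)) * φ v

/-- The tempered distribution `ĝ`, defined by `⟨ĝ, φ⟩ = ⟨g, φ̂⟩` for all Schwartz functions `φ`, is
the function `G`. It is used for bounded continuous `g` and for `G` in `L¹` or `L²`, so that both
integrals converge absolutely. -/
def IsDistributionalFourier {V : Type*} [NormedAddCommGroup V] [InnerProductSpace ℝ V]
    [FiniteDimensional ℝ V] [MeasurableSpace V] [BorelSpace V] (g G : V → ℂ) : Prop :=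
  ∀ φ : 𝓢(V, ℂ), ∫ v, G v * φ v = ∫ v, g v * unitaryFourier φ v

/-- The filter `√(‖η‖² - ‖ξ‖²) ‖η‖ⁿ⁻¹` applied on the Fourier side: if `ĝ = G`, then this is the
Fourier transform of `Kg`. (For `‖η‖ < ‖ξ‖`, where `ĝ` vanishes for `g = Rf`, the square root is
`0`.) -/
def filterK {n : ℕ} (G : DataSpace n → ℂ) (p : DataSpace n) : ℂ :=
  ((Real.sqrt (‖p.snd‖ ^ 2 - ‖p.fst‖ ^ 2) * ‖p.snd‖ ^ (n - 1) : ℝ) : ℂ) * G p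

/-- The constant `cₙ = (2π)⁻ⁿ |Sⁿ| / 2`. -/
def inversionConst (n : ℕ) : ℝ :=
  1 / (2 * Real.pi) ^ n * ((surfaceMeasure n).real Set.univ / 2)

instance (n : ℕ) : IsFiniteMeasure (surfaceMeasure n) :=
  inferInstanceAs (IsFiniteMeasure (volume : Measure (ImageSpace n)).toSphere)

/-- `Rf` is continuous for continuous bounded `f`; in particular it is measurable. -/
theorem continuous_sphericalMean {n : ℕ} {f : ImageSpace n → ℂ} (hf : Continuous f) {C : ℝ}
    (hC : ∀ v, ‖f v‖ ≤ C) : Continuous (sphericalMean f) := by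
  unfold sphericalMean
  simp only [average_eq]
  refine Continuous.const_smul (continuous_of_dominated (bound := fun _ => C) ?_ ?_ ?_ ?_) _
  · intro p
    exact Continuous.aestronglyMeasurable (by fun_prop)
  · exact fun p => Filter.Eventually.of_forall fun σ => hC _
  · exact integrable_const C
  · refine Filter.Eventually.of_forall fun σ => ?_
    fun_prop

/-- `Rf` is bounded for bounded `f`. -/
theorem norm_sphericalMean_le {n : ℕ} {f : ImageSpace n → ℂ} {C : ℝ} (hC : ∀ v, ‖f v‖ ≤ C)
    (p : DataSpace n) : ‖sphericalMean f p‖ ≤ C := by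
  have hC0 : 0 ≤ C := (norm_nonneg _).trans (hC 0)
  unfold sphericalMean
  rw [average_eq, norm_smul, Real.norm_of_nonneg (by positivity)]
  have h1 : ‖∫ σ : sphere (0 : ImageSpace n) 1,
      f (WithLp.toLp 2 (p.fst + ‖p.snd‖ • (σ : ImageSpace n).fst,
        ‖p.snd‖ * (σ : ImageSpace n).snd)) ∂(surfaceMeasure n)‖
      ≤ C * (surfaceMeasure n).real Set.univ :=
    norm_integral_le_of_norm_le_const (Filter.Eventually.of_forall fun σ => hC _)
  refine (mul_le_mul_of_nonneg_left h1 (by positivity)).trans ?_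
  rcases eq_or_ne ((surfaceMeasure n).real Set.univ) 0 with h | h
  · simp [h, hC0]
  · field_simp
    exact le_rfl

end

/-! Insert Fourier inversion for `f` into the spherical mean. The sphere average of the plane wave
with frequency `ζ = (ξ, τ)` depends on `ζ` and `y` only through `⟨x, ξ⟩` and `‖y‖‖ζ‖`, because the
surface measure is rotation invariant. It is therefore also the average over `σ` of the plane waves
on the data space with frequencies `(ξ, ‖ζ‖σ)` (`integral_sphere_exp_translate`). Hence `ĝ` is, up
to a constant, the pushforward of `f̂(ζ) dζ dσ` under `coneMap`.

Polar coordinates in `η` and the substitution `τ = √(‖η‖² - ‖ξ‖²)` show that `dζ dσ` is pushed to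
Lebesgue measure with density `2 * coneWeight` (`map_coneMap`). As `f̂` is even in `τ`, it is a
function of the cone point, so `ĝ` is the explicit integrable function `dataFourier f`.

The filter of `K` is the reciprocal of `coneWeight` on the open cone. Thus the transform of `Kg` is
`f̂` lifted to the cone, which is bounded and rapidly decreasing, and pairing it with the transform
of `Rφ` gives back Parseval's integral for `f` and `φ`. In `‖ĝ‖²` the weight occurs twice: one
factor is absorbed by the change of variables, the other leaves `‖ζ‖^{1-n} / |τ|`, which is not
integrable near the origin if `f̂(0) ≠ 0`. Plancherel transfers this failure from `ĝ` to `g`. -/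

open scoped FourierTransform

noncomputable section

/-! ### Unitary Fourier transform: inversion, Parseval, Plancherel, uniqueness -/

section Fourier

set_option linter.unusedSectionVars false

variable {V : Type*} [NormedAddCommGroup V] [InnerProductSpace ℝ V]
    [FiniteDimensional ℝ V] [MeasurableSpace V] [BorelSpace V]

variable (V) in
/-- The normalizing constant `(2π)^{-d/2}` of the unitary Fourier transform. -/
def fourierConst : ℝ := (2 * Real.pi) ^ (-(Module.finrank ℝ V : ℝ) / 2)

variable (V) in
theorem fourierConst_pos : 0 < fourierConst V := by
  unfold fourierConst; positivity

variable (V) in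
theorem fourierConst_sq : fourierConst V ^ 2 = ((2 * Real.pi) ^ Module.finrank ℝ V)⁻¹ := by
  unfold fourierConst
  rw [← Real.rpow_natCast, ← Real.rpow_mul (by positivity), ← Real.rpow_natCast,
    ← Real.rpow_neg (by positivity)]
  congr 1
  push_cast
  ring

theorem unitaryFourier_eq_fourier (φ : V → ℂ) (ξ : V) :
    unitaryFourier φ ξ = (fourierConst V : ℂ) * 𝓕 φ ((2 * Real.pi)⁻¹ • ξ) := by
  rw [unitaryFourier, fourierConst, Real.fourier_eq']
  congr 2
  ext v
  rw [smul_eq_mul, inner_smul_right]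
  congr 2
  push_cast
  have : (Real.pi : ℂ) ≠ 0 := by exact_mod_cast Real.pi_ne_zero
  field_simp

/-- Homothety by `r ≠ 0` as a continuous linear equivalence. -/
def homothetyEquiv (r : ℝ) (hr : r ≠ 0) : V ≃L[ℝ] V :=
  ContinuousLinearEquiv.smulLeft (Units.mk0 r hr)

/-- The unitary Fourier transform of a Schwartz function, as a Schwartz function. -/
def unitaryFourierSchwartz (φ : 𝓢(V, ℂ)) : 𝓢(V, ℂ) :=
  (fourierConst V : ℂ) • SchwartzMap.compCLMOfContinuousLinearEquiv ℂ
    (homothetyEquiv (2 * Real.pi)⁻¹ (by positivity)) (𝓕 φ)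

theorem coe_unitaryFourierSchwartz (φ : 𝓢(V, ℂ)) :
    (unitaryFourierSchwartz φ : V → ℂ) = unitaryFourier φ := by
  ext ξ
  rw [unitaryFourier_eq_fourier, ← SchwartzMap.fourier_coe]
  rfl

theorem unitaryFourierSchwartz_apply (φ : 𝓢(V, ℂ)) (ξ : V) :
    unitaryFourierSchwartz φ ξ = unitaryFourier φ ξ := by
  rw [coe_unitaryFourierSchwartz]

/-- Rescaling the frequency by `2π` produces the Jacobian `(2π)^{-d}`, the square of `fourierConst`:
one factor stays in front, the other normalizes the transform. -/
theorem unitaryFourier_inversion (φ : 𝓢(V, ℂ)) (v : V) :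
    φ v = (fourierConst V : ℂ) *
      ∫ ξ, Complex.exp (Complex.I * ((inner ℝ v ξ : ℝ) : ℂ)) * unitaryFourierSchwartz φ ξ := by
  have h1 : φ v = 𝓕⁻ (𝓕 (φ : V → ℂ)) v := by
    rw [← SchwartzMap.fourier_coe, ← SchwartzMap.fourierInv_coe]
    simp
  have hpi : (Real.pi : ℂ) ≠ 0 := by exact_mod_cast Real.pi_ne_zero
  rw [h1, Real.fourierInv_eq']
  have h2 := Measure.integral_comp_smul (volume : Measure V) (fun x =>
    Complex.exp (((2 * Real.pi * inner ℝ x v : ℝ) : ℂ) * Complex.I) • 𝓕 (φ : V → ℂ) x)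
    (2 * Real.pi)⁻¹
  rw [inv_pow, inv_inv, abs_of_nonneg (by positivity)] at h2
  have h3 : (∫ x, Complex.exp (((2 * Real.pi * inner ℝ x v : ℝ) : ℂ) * Complex.I) •
      𝓕 (φ : V → ℂ) x) = ((fourierConst V ^ 2 : ℝ) : ℂ) *
      ∫ x : V, Complex.exp (((2 * Real.pi * inner ℝ ((2 * Real.pi)⁻¹ • x) v : ℝ) : ℂ)
        * Complex.I) • 𝓕 (φ : V → ℂ) ((2 * Real.pi)⁻¹ • x) := by
    rw [h2, fourierConst_sq, Complex.real_smul, ← mul_assoc, ← Complex.ofReal_mul,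
      inv_mul_cancel₀ (by positivity), Complex.ofReal_one, one_mul]
  rw [h3]
  push_cast
  rw [sq, mul_assoc, ← integral_const_mul]
  congr 2
  ext x
  rw [unitaryFourierSchwartz_apply, unitaryFourier_eq_fourier, inner_smul_left,
    real_inner_comm, smul_eq_mul]
  have : (2 * (Real.pi : ℂ) * (((starRingEnd ℝ) (2 * Real.pi)⁻¹ * inner ℝ v x : ℝ) : ℂ)
      * Complex.I) = Complex.I * ((inner ℝ v x : ℝ) : ℂ) := by
    simp
    field_simp
  rw [this]
  ring

/-- Transfers a pairing identity from the normalization of `𝓕` to the unitary one, by testing with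
the dilate `φ(2π ·)`. -/
theorem isDistributionalFourier_rescale {g u : V → ℂ}
    (h : ∀ φ : 𝓢(V, ℂ), ∫ v, u v * φ v = ∫ v, g v * 𝓕 (φ : V → ℂ) v) :
    IsDistributionalFourier g
      (fun ξ => (fourierConst V : ℂ) * u ((2 * Real.pi)⁻¹ • ξ)) := by
  intro φ
  have hpi : (0 : ℝ) < 2 * Real.pi := by positivity
  let φs : 𝓢(V, ℂ) := SchwartzMap.compCLMOfContinuousLinearEquiv ℂ
    (homothetyEquiv (2 * Real.pi) hpi.ne') φ
  have hφs : ∀ v, φs v = φ ((2 * Real.pi) • v) := fun v => rfl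
  have h1 : ∀ v, 𝓕 (φs : V → ℂ) v =
      ((((2 * Real.pi) ^ Module.finrank ℝ V)⁻¹ : ℝ) : ℂ) *
        𝓕 (φ : V → ℂ) ((2 * Real.pi)⁻¹ • v) := by
    intro v
    rw [Real.fourier_eq', Real.fourier_eq', ← Complex.real_smul]
    have h2 := Measure.integral_comp_smul (volume : Measure V) (fun x =>
      Complex.exp (((-2 * Real.pi * inner ℝ x ((2 * Real.pi)⁻¹ • v) : ℝ) : ℂ) * Complex.I) •
        φ x) (2 * Real.pi)
    rw [abs_of_nonneg (by positivity)] at h2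
    rw [← h2]
    congr 1
    ext x
    rw [hφs, inner_smul_left, inner_smul_right, ← mul_assoc (starRingEnd ℝ (2 * Real.pi)),
      RCLike.conj_to_real, mul_inv_cancel₀ hpi.ne', one_mul]
  have h3 := Measure.integral_comp_smul (volume : Measure V) (fun x => u x * φs x)
    (2 * Real.pi)⁻¹
  rw [inv_pow, inv_inv, abs_of_nonneg (by positivity), h φs] at h3
  simp only [hφs, smul_smul, mul_inv_cancel₀ hpi.ne', one_smul, h1] at h3
  simp only [mul_assoc, integral_const_mul, unitaryFourier_eq_fourier]
  rw [h3, ← integral_smul, ← integral_const_mul]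
  congr 1
  ext v
  rw [Complex.real_smul]
  have : (((2 * Real.pi) ^ Module.finrank ℝ V : ℝ) : ℂ) ≠ 0 := by
    exact_mod_cast (by positivity : ((2 * Real.pi) ^ Module.finrank ℝ V : ℝ) ≠ 0)
  rw [Complex.ofReal_inv]
  field_simp

/-- The multiplication formula for the unitary Fourier transform. -/
theorem integral_unitaryFourier_mul (f g : 𝓢(V, ℂ)) :
    ∫ v, unitaryFourierSchwartz f v * g v = ∫ v, f v * unitaryFourierSchwartz g v := by
  have h := isDistributionalFourier_rescale (g := f) (u := 𝓕 (f : V → ℂ)) (fun φ => by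
    rw [← SchwartzMap.fourier_coe, ← SchwartzMap.fourier_coe]
    exact SchwartzMap.integral_fourier_mul_eq f φ) g
  simpa only [coe_unitaryFourierSchwartz, ← unitaryFourier_eq_fourier] using h

theorem unitaryFourier_unitaryFourier_neg (φ : 𝓢(V, ℂ)) (v : V) :
    unitaryFourier (fun ξ => unitaryFourierSchwartz φ (-ξ)) v = φ v := by
  rw [unitaryFourier_inversion φ v, unitaryFourier, fourierConst,
    ← integral_neg_eq_self (fun ξ => Complex.exp (Complex.I * ((inner ℝ v ξ : ℝ) : ℂ)) *
      unitaryFourierSchwartz φ ξ)]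
  congr 2
  ext ξ
  simp [real_inner_comm]

/-- Parseval's formula. -/
theorem integral_mul_eq_integral_unitaryFourier (f g : 𝓢(V, ℂ)) :
    ∫ v, f v * g v = ∫ ξ, unitaryFourierSchwartz f ξ * unitaryFourierSchwartz g (-ξ) := by
  let h : 𝓢(V, ℂ) := SchwartzMap.compCLMOfContinuousLinearEquiv ℂ
    (ContinuousLinearEquiv.neg ℝ) (unitaryFourierSchwartz g)
  have h1 : ∀ v, h v = unitaryFourierSchwartz g (-v) := fun v => rfl
  have h2 := integral_unitaryFourier_mul f h
  simp only [h1] at h2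
  rw [h2]
  congr 1
  ext v
  rw [unitaryFourierSchwartz_apply, ← unitaryFourier_unitaryFourier_neg g v]
  rfl

theorem unitaryFourier_comp_isometry (e : V ≃ₗᵢ[ℝ] V) (f : V → ℂ) (ξ : V) :
    unitaryFourier (f ∘ e) ξ = unitaryFourier f (e ξ) := by
  rw [unitaryFourier, unitaryFourier,
    ← e.measurePreserving.integral_comp e.toHomeomorph.measurableEmbedding
      (fun v => Complex.exp (-Complex.I * ((inner ℝ v (e ξ) : ℝ) : ℂ)) * f v)]
  simp [LinearIsometryEquiv.inner_map_map]

/-- A locally integrable function is determined by its distributional pairings. -/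
theorem ae_eq_of_integral_schwartz_eq {G H : V → ℂ} (hG : LocallyIntegrable G)
    (hH : LocallyIntegrable H) (h : ∀ φ : 𝓢(V, ℂ), ∫ v, G v * φ v = ∫ v, H v * φ v) :
    G =ᵐ[volume] H := by
  have h0 := ae_eq_zero_of_integral_contDiff_smul_eq_zero (hG.sub hH) (fun g hg hgc => ?_)
  · filter_upwards [h0] with v hv
    exact sub_eq_zero.mp hv
  · let g' : V → ℂ := fun v => (g v : ℂ)
    have hg' : ContDiff ℝ ∞ g' := Complex.ofRealCLM.contDiff.comp hg
    have hgc' : HasCompactSupport g' := hgc.comp_left (g := Complex.ofReal) Complex.ofReal_zero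
    have := h (hgc'.toSchwartzMap hg')
    have h1 : ∀ v, (hgc'.toSchwartzMap hg') v = (g v : ℂ) := fun v => rfl
    simp only [h1] at this
    have i1 := hG.integrable_smul_left_of_hasCompactSupport hg.continuous hgc
    have i2 := hH.integrable_smul_left_of_hasCompactSupport hg.continuous hgc
    simp only [Pi.sub_apply, smul_sub]
    rw [integral_sub i1 i2, sub_eq_zero]
    simpa [mul_comm] using this

/-- Plancherel: the distributional Fourier transform of an `L²` function is an `L²` function. -/
theorem exists_memLp_isDistributionalFourier {g : V → ℂ} (hg : MemLp g 2 volume) :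
    ∃ G : V → ℂ, MemLp G 2 volume ∧ IsDistributionalFourier g G := by
  have hpi : (0 : ℝ) < 2 * Real.pi := by positivity
  let u : Lp ℂ 2 (volume : Measure V) := 𝓕 (hg.toLp g)
  have key : ∀ φ : 𝓢(V, ℂ), ∫ v, u v * φ v = ∫ v, g v * 𝓕 φ v := by
    intro φ
    have h := congrArg (fun T : 𝓢'(V, ℂ) => T φ)
      (Lp.fourier_toTemperedDistribution_eq (hg.toLp g))
    simp only [TemperedDistribution.fourier_apply, Lp.toTemperedDistribution_apply] at h
    rw [show (∫ v, u v * φ v) = ∫ v, φ v • u v from by simp [mul_comm], ← h]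
    refine integral_congr_ae ?_
    filter_upwards [hg.coeFn_toLp] with v hv
    rw [hv, smul_eq_mul, mul_comm]
  refine ⟨fun ξ => (fourierConst V : ℂ) * u ((2 * Real.pi)⁻¹ • ξ), MemLp.const_mul ?_ _,
    isDistributionalFourier_rescale fun φ => by simpa only [SchwartzMap.fourier_coe] using key φ⟩
  -- A dilation only multiplies Lebesgue measure by a finite constant, so it preserves `L²`.
  have hm := Measure.map_addHaar_smul (volume : Measure V) (inv_ne_zero hpi.ne')
  have hu : MemLp u 2 (Measure.map (fun v : V => (2 * Real.pi)⁻¹ • v) volume) := by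
    rw [hm]
    exact (Lp.memLp u).smul_measure ENNReal.ofReal_ne_top
  exact hu.comp_of_map (by fun_prop)

end Fourier

/-! ### One-dimensional substitutions -/

section OneDim

theorem lintegral_comp_abs_eq (g : ℝ → ℝ≥0∞) :
    ∫⁻ t, g |t| = 2 * ∫⁻ t in Set.Ioi (0 : ℝ), g t := by
  have h1 : ∫⁻ t in Set.Ioi (0 : ℝ), g |t| = ∫⁻ t in Set.Ioi (0 : ℝ), g t :=
    setLIntegral_congr_fun measurableSet_Ioi fun t ht => by rw [abs_of_pos ht]
  have h2 : ∫⁻ t in Set.Iic (0 : ℝ), g |t| = ∫⁻ t in Set.Ioi (0 : ℝ), g t := by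
    rw [← h1, ← setLIntegral_congr (Iio_ae_eq_Iic (a := (0 : ℝ)))]
    have := (Measure.measurePreserving_neg (volume : Measure ℝ)).setLIntegral_comp_preimage_emb
      (MeasurableEquiv.neg ℝ).measurableEmbedding (fun t => g |t|) (Set.Ioi 0)
    simpa using this
  rw [← lintegral_add_compl _ (measurableSet_Iic (a := (0 : ℝ))), Set.compl_Iic, h1, h2, two_mul]

/-- The substitution `t = √(ρ² - a²)`. -/
theorem lintegral_sqrt_sq_sub_sq {a : ℝ} (ha : 0 ≤ a) (h : ℝ → ℝ≥0∞) :
    ∫⁻ r in Set.Ioi (0 : ℝ), ENNReal.ofReal (r / √(r ^ 2 - a ^ 2)) * h r =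
      ∫⁻ t in Set.Ioi (0 : ℝ), h √(a ^ 2 + t ^ 2) := by
  have hpos : ∀ r ∈ Set.Ioi a, 0 < r ^ 2 - a ^ 2 := fun r (hr : a < r) => by nlinarith
  have himage : (fun r : ℝ => √(r ^ 2 - a ^ 2)) '' Set.Ioi a = Set.Ioi 0 := by
    ext t
    constructor
    · rintro ⟨r, hr, rfl⟩
      exact Real.sqrt_pos.mpr (hpos r hr)
    · intro (ht : 0 < t)
      refine ⟨√(a ^ 2 + t ^ 2), ?_, ?_⟩
      · exact Real.lt_sqrt_of_sq_lt (by nlinarith)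
      · dsimp only
        rw [Real.sq_sqrt (by positivity), add_sub_cancel_left, Real.sqrt_sq ht.le]
  have hback : ∀ r ∈ Set.Ioi a, √(a ^ 2 + √(r ^ 2 - a ^ 2) ^ 2) = r := fun r hr => by
    rw [Real.sq_sqrt (hpos r hr).le, add_sub_cancel, Real.sqrt_sq (ha.trans (le_of_lt hr))]
  have hinj : Set.InjOn (fun r : ℝ => √(r ^ 2 - a ^ 2)) (Set.Ioi a) := fun r hr s hs hrs => by
    rw [← hback r hr, ← hback s hs]
    simp only at hrs
    rw [hrs]
  have hder : ∀ r ∈ Set.Ioi a, HasDerivWithinAt (fun r : ℝ => √(r ^ 2 - a ^ 2))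
      (r / √(r ^ 2 - a ^ 2)) (Set.Ioi a) r := fun r hr => by
    have h1 : HasDerivAt (fun r : ℝ => r ^ 2 - a ^ 2) (2 * r) r := by
      simpa using (hasDerivAt_pow 2 r).sub_const (a ^ 2)
    have h2 := (h1.sqrt (hpos r hr).ne').hasDerivWithinAt (s := Set.Ioi a)
    rwa [mul_div_mul_left _ _ two_ne_zero] at h2
  have hsub := lintegral_image_eq_lintegral_abs_deriv_mul measurableSet_Ioi hder hinj
    (fun t => h √(a ^ 2 + t ^ 2))
  rw [himage] at hsub
  rw [hsub, ← lintegral_indicator measurableSet_Ioi, ← lintegral_indicator measurableSet_Ioi]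
  refine lintegral_congr fun r => ?_
  by_cases hr : a < r
  · rw [Set.indicator_of_mem (Set.mem_Ioi.mpr (ha.trans_lt hr)),
      Set.indicator_of_mem (Set.mem_Ioi.mpr hr), hback r hr, abs_of_nonneg]
    exact div_nonneg (ha.trans hr.le) (Real.sqrt_nonneg _)
  · rw [Set.indicator_of_notMem (s := Set.Ioi a) (by simpa using hr)]
    by_cases hr0 : 0 < r
    -- For `0 < r ≤ a` the root is `0` and division by zero gives `0`, so the left side has no mass
    -- there.
    · have : r ^ 2 - a ^ 2 ≤ 0 := by nlinarith [not_lt.mp hr]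
      rw [Set.indicator_of_mem (Set.mem_Ioi.mpr hr0), Real.sqrt_eq_zero_of_nonpos this]
      simp
    · rw [Set.indicator_of_notMem (by simpa using hr0)]

end OneDim

/-! ### Polar coordinates for the lower integral -/

section Polar

/-- Integration in polar coordinates. -/
theorem lintegral_eq_lintegral_polar {E : Type*} [NormedAddCommGroup E] [NormedSpace ℝ E]
    [MeasurableSpace E] [BorelSpace E] [FiniteDimensional ℝ E] [Nontrivial E] (μ : Measure E)
    [μ.IsAddHaarMeasure] {F : E → ℝ≥0∞} (hF : Measurable F) :
    ∫⁻ v, F v ∂μ = ∫⁻ r in Set.Ioi (0 : ℝ), ENNReal.ofReal (r ^ (Module.finrank ℝ E - 1)) *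
      ∫⁻ σ : sphere (0 : E) 1, F (r • (σ : E)) ∂μ.toSphere := by
  have h1 : ∫⁻ v, F v ∂μ = ∫⁻ v : ({0}ᶜ : Set E), F v ∂(μ.comap (↑)) := by
    rw [lintegral_subtype_comap (measurableSet_singleton _).compl, restrict_compl_singleton]
  have h2 : ∀ v : ({0}ᶜ : Set E), F v =
      (fun p : sphere (0 : E) 1 × Set.Ioi (0 : ℝ) => F ((p.2 : ℝ) • (p.1 : E)))
        (homeomorphUnitSphereProd E v) := fun v => by
    have := congrArg Subtype.val ((homeomorphUnitSphereProd E).symm_apply_apply v)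
    rw [homeomorphUnitSphereProd_symm_apply_coe] at this
    simp only [this]
  have hF2 : Measurable fun p : sphere (0 : E) 1 × Set.Ioi (0 : ℝ) =>
      F ((p.2 : ℝ) • (p.1 : E)) := hF.comp (by fun_prop)
  have hF3 : Measurable fun p : sphere (0 : E) 1 × ℝ => F (p.2 • (p.1 : E)) :=
    hF.comp (by fun_prop)
  rw [h1, lintegral_congr h2,
    μ.measurePreserving_homeomorphUnitSphereProd.lintegral_comp hF2,
    lintegral_prod_symm _ hF2.aemeasurable, Measure.volumeIoiPow,
    lintegral_withDensity_eq_lintegral_mul _ (by fun_prop) hF2.lintegral_prod_left']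
  exact lintegral_subtype_comap measurableSet_Ioi
    (fun r : ℝ => ENNReal.ofReal (r ^ (Module.finrank ℝ E - 1)) *
      ∫⁻ σ : sphere (0 : E) 1, F (r • (σ : E)) ∂μ.toSphere)

end Polar

/-! ### The cone parametrization and its Jacobian -/

section Cone

variable {n : ℕ}

theorem finrank_imageSpace (n : ℕ) : Module.finrank ℝ (ImageSpace n) = n + 1 := by
  rw [(WithLp.linearEquiv 2 ℝ (EuclideanSpace ℝ (Fin n) × ℝ)).finrank_eq]
  simp

theorem finrank_dataSpace (n : ℕ) : Module.finrank ℝ (DataSpace n) = 2 * n + 1 := by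
  rw [(WithLp.linearEquiv 2 ℝ
    (EuclideanSpace ℝ (Fin n) × EuclideanSpace ℝ (Fin (n + 1)))).finrank_eq]
  simp
  ring

instance (n : ℕ) : Nontrivial (ImageSpace n) :=
  Module.nontrivial_of_finrank_pos (R := ℝ) (by rw [finrank_imageSpace]; omega)

/-- An isometric identification of `ℝⁿ × ℝ` with `ℝⁿ⁺¹`. -/
def imageIso (n : ℕ) : ImageSpace n ≃ₗᵢ[ℝ] EuclideanSpace ℝ (Fin (n + 1)) :=
  ((stdOrthonormalBasis ℝ (ImageSpace n)).reindex (finCongr (finrank_imageSpace n))).repr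

/-- The map `((ξ, τ), σ) ↦ (ξ, √(‖ξ‖² + τ²) σ)` onto the cone `‖ξ‖ ≤ ‖η‖`. -/
def coneMap (p : ImageSpace n × sphere (0 : ImageSpace n) 1) : DataSpace n :=
  WithLp.toLp 2 (p.1.fst, ‖p.1‖ • imageIso n (p.2 : ImageSpace n))

/-- The weight `‖η‖^{1-n} / √(‖η‖² - ‖ξ‖²)` on the cone `‖ξ‖ < ‖η‖`; it is `0` elsewhere. -/
def coneWeight (q : DataSpace n) : ℝ :=
  ‖q.snd‖ / (‖q.snd‖ ^ n * √(‖q.snd‖ ^ 2 - ‖q.fst‖ ^ 2))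

theorem coneWeight_nonneg (q : DataSpace n) : 0 ≤ coneWeight q := by
  unfold coneWeight; positivity

theorem measurable_coneWeight : Measurable (coneWeight : DataSpace n → ℝ) := by
  unfold coneWeight
  have h1 : Measurable fun q : DataSpace n => q.snd :=
    (WithLp.prod_continuous_ofLp 2 _ _).snd.measurable
  have h2 : Measurable fun q : DataSpace n => q.fst :=
    (WithLp.prod_continuous_ofLp 2 _ _).fst.measurable
  fun_prop

theorem continuous_coneMap : Continuous (coneMap (n := n)) := by
  unfold coneMap
  fun_prop

theorem norm_sq_imageSpace (ζ : ImageSpace n) : ‖ζ‖ ^ 2 = ‖ζ.fst‖ ^ 2 + ζ.snd ^ 2 := by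
  rw [WithLp.prod_norm_sq_eq_of_L2, Real.norm_eq_abs, sq_abs]

/-- The change of variables on the fibre over fixed `x`: polar coordinates give `rⁿ dr dσ`, and `t =
√(r² - ‖x‖²)` gives `dt = r / t dr`. The factor 2 counts the two signs of `t`, which have the same
image under `coneMap`. -/
theorem lintegral_sphere_coneWeight {F : DataSpace n → ℝ≥0∞} (hF : Measurable F)
    (x : EuclideanSpace ℝ (Fin n)) :
    ∫⁻ y, ENNReal.ofReal (2 * coneWeight (WithLp.toLp 2 (x, y))) * F (WithLp.toLp 2 (x, y)) =
      ∫⁻ t : ℝ, ∫⁻ σ, F (coneMap (WithLp.toLp 2 (x, t), σ)) ∂surfaceMeasure n := by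
  let h : ℝ → ℝ≥0∞ := fun r => ∫⁻ σ : sphere (0 : ImageSpace n) 1,
    F (WithLp.toLp 2 (x, r • imageIso n (σ : ImageSpace n))) ∂surfaceMeasure n
  have hR : ∀ t : ℝ, ∫⁻ σ, F (coneMap (WithLp.toLp 2 (x, t), σ)) ∂surfaceMeasure n =
      (fun t => h √(‖x‖ ^ 2 + t ^ 2)) |t| := fun t => by
    have : ‖(WithLp.toLp 2 (x, t) : ImageSpace n)‖ = √(‖x‖ ^ 2 + t ^ 2) := by
      rw [← Real.sqrt_sq (norm_nonneg _), norm_sq_imageSpace]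
      rfl
    simp only [coneMap, this, sq_abs, h]
    rfl
  have hm : Measurable fun y : EuclideanSpace ℝ (Fin (n + 1)) =>
      ENNReal.ofReal (2 * coneWeight (WithLp.toLp 2 (x, y))) * F (WithLp.toLp 2 (x, y)) := by
    have h1 : Measurable fun y : EuclideanSpace ℝ (Fin (n + 1)) =>
      (WithLp.toLp 2 (x, y) : DataSpace n) := by fun_prop
    exact ((measurable_coneWeight.comp h1).const_mul 2).ennreal_ofReal.mul (hF.comp h1)
  rw [lintegral_congr hR, lintegral_comp_abs_eq fun t => h √(‖x‖ ^ 2 + t ^ 2),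
    ← lintegral_sqrt_sq_sub_sq (norm_nonneg x) h,
    ← (imageIso n).measurePreserving.lintegral_comp hm]
  refine (lintegral_eq_lintegral_polar volume
    (hm.comp (imageIso n).continuous.measurable)).trans ?_
  rw [finrank_imageSpace, Nat.add_sub_cancel, ← lintegral_const_mul' _ _ ENNReal.ofNat_ne_top]
  refine setLIntegral_congr_fun measurableSet_Ioi fun r (hr : 0 < r) => ?_
  simp only [Function.comp_apply]
  have hw : ∀ σ : sphere (0 : ImageSpace n) 1, coneWeight
      (WithLp.toLp 2 (x, imageIso n (r • (σ : ImageSpace n)))) =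
      r / (r ^ n * √(r ^ 2 - ‖x‖ ^ 2)) := fun σ => by
    have h1 : ‖imageIso n (r • (σ : ImageSpace n))‖ = r := by
      rw [LinearIsometryEquiv.norm_map, norm_smul, mem_sphere_zero_iff_norm.mp σ.2, mul_one,
        Real.norm_of_nonneg hr.le]
    change ‖imageIso n (r • (σ : ImageSpace n))‖ /
      (‖imageIso n (r • (σ : ImageSpace n))‖ ^ n *
        √(‖imageIso n (r • (σ : ImageSpace n))‖ ^ 2 - ‖x‖ ^ 2)) = _
    rw [h1]
  simp_rw [hw]
  rw [lintegral_const_mul' _ _ ENNReal.ofReal_ne_top, ← mul_assoc, ← mul_assoc,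
    ← ENNReal.ofReal_mul (by positivity)]
  simp only [map_smul]
  congr 1
  have h2 : ∀ s : ℝ, 2 * ENNReal.ofReal s = ENNReal.ofReal (2 * s) := fun s => by
    rw [ENNReal.ofReal_mul zero_le_two, ENNReal.ofReal_ofNat]
  rw [h2]
  congr 1
  -- On and outside the cone's boundary both densities are `0` by the convention for division by
  -- zero.
  rcases eq_or_ne √(r ^ 2 - ‖x‖ ^ 2) 0 with h0 | h0
  · simp [h0]
  · field_simp

/-- The cone map transports the product measure to the weighted Lebesgue measure. -/
theorem map_coneMap : Measure.map coneMap ((volume : Measure (ImageSpace n)).prod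
    (surfaceMeasure n)) = volume.withDensity fun q => ENNReal.ofReal (2 * coneWeight q) := by
  have hw : Measurable fun q : DataSpace n => ENNReal.ofReal (2 * coneWeight q) :=
    (measurable_coneWeight.const_mul 2).ennreal_ofReal
  refine Measure.ext_of_lintegral _ fun F hF => ?_
  have hFc : Measurable fun p => F (coneMap (n := n) p) :=
    hF.comp continuous_coneMap.measurable
  rw [lintegral_map hF continuous_coneMap.measurable, lintegral_prod _ hFc.aemeasurable,
    lintegral_withDensity_eq_lintegral_mul _ hw hF,
    ← (WithLp.volume_preserving_toLp (EuclideanSpace ℝ (Fin n)) ℝ).lintegral_comp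
      hFc.lintegral_prod_right',
    ← (WithLp.volume_preserving_toLp (EuclideanSpace ℝ (Fin n))
      (EuclideanSpace ℝ (Fin (n + 1)))).lintegral_comp (hw.mul hF),
    Measure.volume_eq_prod, Measure.volume_eq_prod, lintegral_prod, lintegral_prod]
  · exact lintegral_congr fun x => (lintegral_sphere_coneWeight hF x).symm
  · exact ((hw.mul hF).comp (by fun_prop)).aemeasurable
  · exact (hFc.lintegral_prod_right'.comp (by fun_prop)).aemeasurable

theorem integrable_coneWeight_smul_iff {E : Type*} [NormedAddCommGroup E] [NormedSpace ℝ E]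
    {K : DataSpace n → E} (hK : StronglyMeasurable K) :
    Integrable (fun q => (2 * coneWeight q) • K q) ↔
      Integrable (fun p => K (coneMap p)) (volume.prod (surfaceMeasure n)) := by
  have hw : Measurable fun q : DataSpace n => ENNReal.ofReal (2 * coneWeight q) :=
    (measurable_coneWeight.const_mul 2).ennreal_ofReal
  have h := integrable_map_measure (μ := (volume : Measure (ImageSpace n)).prod
    (surfaceMeasure n)) (hK.aestronglyMeasurable) continuous_coneMap.measurable.aemeasurable
  rw [map_coneMap, integrable_withDensity_iff_integrable_smul' hw
    (.of_forall fun _ => ENNReal.ofReal_lt_top)] at h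
  simp only [ENNReal.toReal_ofReal (mul_nonneg zero_le_two (coneWeight_nonneg _))] at h
  exact h

theorem integral_coneWeight_smul {E : Type*} [NormedAddCommGroup E] [NormedSpace ℝ E]
    {K : DataSpace n → E} (hK : StronglyMeasurable K) :
    ∫ q, (2 * coneWeight q) • K q =
      ∫ p, K (coneMap p) ∂(volume.prod (surfaceMeasure n)) := by
  have hw : Measurable fun q : DataSpace n => ENNReal.ofReal (2 * coneWeight q) :=
    (measurable_coneWeight.const_mul 2).ennreal_ofReal
  rw [← integral_map continuous_coneMap.measurable.aemeasurable hK.aestronglyMeasurable,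
    map_coneMap, integral_withDensity_eq_integral_toReal_smul hw
      (.of_forall fun _ => ENNReal.ofReal_lt_top)]
  simp only [ENNReal.toReal_ofReal (mul_nonneg zero_le_two (coneWeight_nonneg _))]

end Cone

/-! ### Rotation invariance of the surface measure -/

open scoped Pointwise in
/-- The surface measure is invariant under linear isometries. -/
theorem measurePreserving_toSphere {E : Type*} [NormedAddCommGroup E] [InnerProductSpace ℝ E]
    [MeasurableSpace E] [BorelSpace E] [FiniteDimensional ℝ E] (e : E ≃ₗᵢ[ℝ] E) :
    MeasurePreserving (fun σ : sphere (0 : E) 1 => (⟨e σ, by simp⟩ : sphere (0 : E) 1))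
      (volume : Measure E).toSphere (volume : Measure E).toSphere := by
  have hm : Measurable (fun σ : sphere (0 : E) 1 => (⟨e σ, by simp⟩ : sphere (0 : E) 1)) :=
    (Continuous.subtype_mk (by fun_prop) _).measurable
  refine ⟨hm, Measure.ext fun s hs => ?_⟩
  rw [Measure.map_apply hm hs, Measure.toSphere_apply' _ (hm hs), Measure.toSphere_apply' _ hs,
    ← e.measurePreserving.measure_preimage_emb e.toHomeomorph.measurableEmbedding
      (Set.Ioo (0 : ℝ) 1 • (Subtype.val '' s))]
  congr 2
  ext v
  simp only [Set.mem_smul, Set.mem_image, Set.mem_preimage]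
  constructor
  · rintro ⟨r, hr, w, ⟨σ, hσ, rfl⟩, rfl⟩
    exact ⟨r, hr, e σ, ⟨_, hσ, rfl⟩, by simp⟩
  · rintro ⟨r, hr, w, ⟨σ, hσ, rfl⟩, h⟩
    refine ⟨r, hr, e.symm σ, ⟨⟨e.symm σ, by simp⟩, by simpa using hσ, rfl⟩, ?_⟩
    rw [← map_smul, h, e.symm_apply_apply]

/-! ### Spherical means as superpositions of plane waves -/

section SphericalMean

variable {n : ℕ}

/-- The characteristic function of the surface measure is radial. -/
theorem integral_sphere_exp_eq {a b : ImageSpace n} (hab : ‖a‖ = ‖b‖) :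
    ∫ σ : sphere (0 : ImageSpace n) 1,
        Complex.exp (Complex.I * ((inner ℝ (σ : ImageSpace n) a : ℝ) : ℂ)) ∂surfaceMeasure n =
      ∫ σ : sphere (0 : ImageSpace n) 1,
        Complex.exp (Complex.I * ((inner ℝ (σ : ImageSpace n) b : ℝ) : ℂ)) ∂surfaceMeasure n := by
  -- For vectors of equal norm, the reflection in the hyperplane orthogonal to `a - b` carries `a`
  -- to `b`.
  let e : ImageSpace n ≃ₗᵢ[ℝ] ImageSpace n := (Submodule.span ℝ {a - b})ᗮ.reflection
  have he : e a = b := Submodule.reflection_sub hab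
  have hmp := measurePreserving_toSphere e
  have hemb : MeasurableEmbedding (fun σ : sphere (0 : ImageSpace n) 1 =>
      (⟨e σ, by simp⟩ : sphere (0 : ImageSpace n) 1)) :=
    (Continuous.isClosedEmbedding (Continuous.subtype_mk (by fun_prop) _) fun σ τ h =>
      Subtype.ext (e.injective (congrArg Subtype.val h))).measurableEmbedding
  have h := hmp.integral_comp hemb (fun σ : sphere (0 : ImageSpace n) 1 =>
    Complex.exp (Complex.I * ((inner ℝ (σ : ImageSpace n) b : ℝ) : ℂ)))
  refine Eq.trans ?_ h
  simp only [← he, LinearIsometryEquiv.inner_map_map]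
  rfl

theorem norm_exp_I_mul_ofReal (t : ℝ) : ‖Complex.exp (Complex.I * (t : ℂ))‖ = 1 := by
  rw [mul_comm, Complex.norm_exp_ofReal_mul_I]

/-- After removing the common phase `⟨x, ξ⟩`, both sides are the characteristic function of the
surface measure, at `‖y‖ζ` and at a copy of `‖ζ‖y`. These have equal norm, so the roles of `y` and
`ζ` can be exchanged. -/
theorem integral_sphere_exp_translate (p : DataSpace n) (ζ : ImageSpace n) :
    ∫ σ : sphere (0 : ImageSpace n) 1, Complex.exp (Complex.I * ((inner ℝ
        (WithLp.toLp 2 (p.fst + ‖p.snd‖ • (σ : ImageSpace n).fst,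
          ‖p.snd‖ * (σ : ImageSpace n).snd) : ImageSpace n) ζ : ℝ) : ℂ)) ∂surfaceMeasure n =
      ∫ σ : sphere (0 : ImageSpace n) 1, Complex.exp (Complex.I *
        ((inner ℝ p (coneMap (ζ, σ)) : ℝ) : ℂ)) ∂surfaceMeasure n := by
  have h1 : ∀ σ : ImageSpace n, inner ℝ (WithLp.toLp 2 (p.fst + ‖p.snd‖ • σ.fst,
      ‖p.snd‖ * σ.snd) : ImageSpace n) ζ =
      inner ℝ p.fst ζ.fst + inner ℝ σ (‖p.snd‖ • ζ) := fun σ => by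
    rw [WithLp.prod_inner_apply, inner_smul_right, WithLp.prod_inner_apply]
    change inner ℝ (p.fst + ‖p.snd‖ • σ.fst) ζ.fst + inner ℝ (‖p.snd‖ * σ.snd) ζ.snd =
      inner ℝ p.fst ζ.fst + ‖p.snd‖ * (inner ℝ σ.fst ζ.fst + inner ℝ σ.snd ζ.snd)
    rw [inner_add_left, real_inner_smul_left, ← smul_eq_mul (‖p.snd‖) σ.snd,
      real_inner_smul_left]
    ring
  have h2 : ∀ σ : sphere (0 : ImageSpace n) 1, inner ℝ p (coneMap (ζ, σ)) =
      inner ℝ p.fst ζ.fst +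
        inner ℝ (σ : ImageSpace n) (‖ζ‖ • (imageIso n).symm p.snd) := fun σ => by
    rw [WithLp.prod_inner_apply]
    change inner ℝ p.fst ζ.fst + inner ℝ p.snd (‖ζ‖ • imageIso n (σ : ImageSpace n)) = _
    rw [inner_smul_right, inner_smul_right, real_inner_comm _ p.snd,
      ← (imageIso n).inner_map_map (σ : ImageSpace n), LinearIsometryEquiv.apply_symm_apply]
  simp only [h1, h2, Complex.ofReal_add, mul_add, Complex.exp_add]
  rw [integral_const_mul, integral_const_mul, integral_sphere_exp_eq]
  simp [norm_smul, mul_comm]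

/-- The product of Lebesgue measure with the surface measure. -/
abbrev coneMeasure (n : ℕ) : Measure (ImageSpace n × sphere (0 : ImageSpace n) 1) :=
  volume.prod (surfaceMeasure n)

instance (n : ℕ) : SFinite (coneMeasure n) := Measure.prod.instSFinite

/-- The total surface measure of the sphere. -/
def sphereArea (n : ℕ) : ℝ := (surfaceMeasure n).real Set.univ

theorem sphereArea_pos (n : ℕ) : 0 < sphereArea n := by
  have : (surfaceMeasure n) ≠ 0 := Measure.toSphere_ne_zero volume
  rw [sphereArea, measureReal_def]
  exact ENNReal.toReal_pos (by simpa using this) (measure_ne_top _ _)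

theorem integrable_fst_coneMeasure {F : ImageSpace n → ℂ} (hF : Integrable F) :
    Integrable (fun z => F z.1) (coneMeasure n) := hF.comp_fst _

/-- The spherical mean of `f` is a superposition of plane waves with frequencies in the cone. -/
theorem sphericalMean_eq_integral (f : 𝓢(ImageSpace n, ℂ)) (p : DataSpace n) :
    sphericalMean f p = ((sphereArea n)⁻¹ * fourierConst (ImageSpace n) : ℝ) *
      ∫ z, Complex.exp (Complex.I * ((inner ℝ p (coneMap z) : ℝ) : ℂ)) *
        unitaryFourierSchwartz f z.1 ∂coneMeasure n := by
  have hI := integrable_fst_coneMeasure (unitaryFourierSchwartz f).integrable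
  have h1 : Integrable (fun z : ImageSpace n × sphere (0 : ImageSpace n) 1 =>
      Complex.exp (Complex.I * ((inner ℝ p (coneMap z) : ℝ) : ℂ)) *
        unitaryFourierSchwartz f z.1) (coneMeasure n) := by
    have := continuous_coneMap (n := n)
    refine hI.bdd_mul (c := 1) (Continuous.aestronglyMeasurable (by fun_prop))
      (.of_forall fun z => (norm_exp_I_mul_ofReal _).le)
  let A : sphere (0 : ImageSpace n) 1 → ImageSpace n := fun σ =>
    WithLp.toLp 2 (p.fst + ‖p.snd‖ • (σ : ImageSpace n).fst, ‖p.snd‖ * (σ : ImageSpace n).snd)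
  have hA : Continuous A := by fun_prop
  have h2 : Integrable (fun z : ImageSpace n × sphere (0 : ImageSpace n) 1 =>
      Complex.exp (Complex.I * ((inner ℝ (A z.2) z.1 : ℝ) : ℂ)) *
        unitaryFourierSchwartz f z.1) (coneMeasure n) := by
    refine hI.bdd_mul (c := 1) (Continuous.aestronglyMeasurable (by fun_prop))
      (.of_forall fun z => (norm_exp_I_mul_ofReal _).le)
  have h3 : ∫ σ, f (A σ) ∂surfaceMeasure n = (fourierConst (ImageSpace n) : ℂ) *
      ∫ σ, ∫ ζ, Complex.exp (Complex.I * ((inner ℝ (A σ) ζ : ℝ) : ℂ)) *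
        unitaryFourierSchwartz f ζ ∂volume ∂surfaceMeasure n := by
    rw [← integral_const_mul]
    exact integral_congr_ae (.of_forall fun σ => unitaryFourier_inversion f (A σ))
  rw [sphericalMean, average_eq, h3, integral_integral_swap (f := fun σ ζ => Complex.exp (Complex.I *
      ((inner ℝ (A σ) ζ : ℝ) : ℂ)) * unitaryFourierSchwartz f ζ) h2.swap, integral_prod _ h1]
  have h4 : ∀ ζ : ImageSpace n, ∫ σ, Complex.exp (Complex.I * ((inner ℝ (A σ) ζ : ℝ) : ℂ)) *
        unitaryFourierSchwartz f ζ ∂surfaceMeasure n =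
      ∫ σ, Complex.exp (Complex.I * ((inner ℝ p (coneMap (ζ, σ)) : ℝ) : ℂ)) *
        unitaryFourierSchwartz f ζ ∂surfaceMeasure n := fun ζ => by
    rw [integral_mul_const, integral_mul_const, integral_sphere_exp_translate]
  simp_rw [h4]
  rw [Complex.real_smul, sphereArea]
  push_cast
  ring

/-- By Fubini the plane waves are integrated against `φ̂` first, and inversion turns that integral
into the value of `φ` at the cone point. This identifies `ĝ` as a pushforward; evenness is not
needed yet. -/
theorem integral_sphericalMean_mul_unitaryFourier (f : 𝓢(ImageSpace n, ℂ))
    (φ : 𝓢(DataSpace n, ℂ)) :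
    ∫ p, sphericalMean f p * unitaryFourier φ p =
      ((sphereArea n)⁻¹ * fourierConst (ImageSpace n) * (fourierConst (DataSpace n))⁻¹ : ℝ) *
      ∫ z, unitaryFourierSchwartz f z.1 * φ (coneMap z) ∂coneMeasure n := by
  have hI := integrable_fst_coneMeasure (unitaryFourierSchwartz f).integrable
  have hc := continuous_coneMap (n := n)
  have h1 : Integrable (fun w : DataSpace n × (ImageSpace n × sphere (0 : ImageSpace n) 1) =>
      Complex.exp (Complex.I * ((inner ℝ w.1 (coneMap w.2) : ℝ) : ℂ)) *
        (unitaryFourierSchwartz φ w.1 * unitaryFourierSchwartz f w.2.1))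
      (volume.prod (coneMeasure n)) := by
    refine ((unitaryFourierSchwartz φ).integrable.mul_prod hI).bdd_mul (c := 1)
      (Continuous.aestronglyMeasurable (by fun_prop))
      (.of_forall fun z => (norm_exp_I_mul_ofReal _).le)
  have h2 : ∀ p, sphericalMean f p * unitaryFourier φ p =
      ((sphereArea n)⁻¹ * fourierConst (ImageSpace n) : ℝ) *
      ∫ z, Complex.exp (Complex.I * ((inner ℝ p (coneMap z) : ℝ) : ℂ)) *
        (unitaryFourierSchwartz φ p * unitaryFourierSchwartz f z.1) ∂coneMeasure n := fun p => by
    rw [sphericalMean_eq_integral, mul_assoc, ← integral_mul_const]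
    congr 2
    ext z
    rw [unitaryFourierSchwartz_apply φ]
    ring
  simp_rw [h2]
  rw [integral_const_mul, integral_integral_swap h1, Complex.ofReal_mul _ (fourierConst _)⁻¹,
    mul_assoc, ← integral_const_mul (Complex.ofReal (fourierConst (DataSpace n))⁻¹)]
  congr 2
  ext z
  rw [unitaryFourier_inversion φ (coneMap z), mul_left_comm, ← mul_assoc (Complex.ofReal _),
    ← Complex.ofReal_mul, inv_mul_cancel₀ (fourierConst_pos _).ne', Complex.ofReal_one, one_mul,
    ← integral_const_mul]
  congr 1
  ext p
  rw [real_inner_comm]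
  ring

/-! ### Even functions as functions on the cone -/

/-- The reflection `(x, y) ↦ (x, -y)`. -/
def flipLast (n : ℕ) : ImageSpace n ≃ₗᵢ[ℝ] ImageSpace n where
  toFun v := WithLp.toLp 2 (v.fst, -v.snd)
  invFun v := WithLp.toLp 2 (v.fst, -v.snd)
  map_add' v w := by
    apply (WithLp.equiv 2 _).injective
    exact Prod.ext rfl (neg_add _ _)
  map_smul' r v := by
    apply (WithLp.equiv 2 _).injective
    exact Prod.ext rfl (smul_neg r v.snd).symm
  left_inv v := by
    apply (WithLp.equiv 2 _).injective
    exact Prod.ext rfl (neg_neg v.snd)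
  right_inv v := by
    apply (WithLp.equiv 2 _).injective
    exact Prod.ext rfl (neg_neg v.snd)
  norm_map' v := by
    rw [← sq_eq_sq₀ (norm_nonneg _) (norm_nonneg _), norm_sq_imageSpace, norm_sq_imageSpace]
    change ‖v.fst‖ ^ 2 + (-v.snd) ^ 2 = _
    rw [neg_sq]

theorem EvenInLast.comp_flipLast {f : ImageSpace n → ℂ} (hf : EvenInLast f) :
    f ∘ flipLast n = f := by
  ext v
  exact hf v.fst v.snd

theorem EvenInLast.unitaryFourier {f : ImageSpace n → ℂ} (hf : EvenInLast f) :
    EvenInLast (unitaryFourier f) := fun x y => by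
  have h := unitaryFourier_comp_isometry (flipLast n) f (WithLp.toLp 2 (x, y))
  rw [hf.comp_flipLast] at h
  exact h.symm

theorem EvenInLast.abs_snd {f : ImageSpace n → ℂ} (hf : EvenInLast f)
    (x : EuclideanSpace ℝ (Fin n)) (y : ℝ) :
    f (WithLp.toLp 2 (x, |y|)) = f (WithLp.toLp 2 (x, y)) := by
  rcases abs_choice y with h | h <;> rw [h]
  exact hf x y

theorem coneMap_fst (z : ImageSpace n × sphere (0 : ImageSpace n) 1) :
    (coneMap z).fst = z.1.fst := rfl

theorem norm_coneMap_snd (z : ImageSpace n × sphere (0 : ImageSpace n) 1) :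
    ‖(coneMap z).snd‖ = ‖z.1‖ := by
  change ‖‖z.1‖ • imageIso n (z.2 : ImageSpace n)‖ = _
  rw [norm_smul, norm_norm, LinearIsometryEquiv.norm_map, mem_sphere_zero_iff_norm.mp z.2.2,
    mul_one]

/-- The height `√(‖η‖² - ‖ξ‖²)` of a point of the cone. -/
def coneHeight (q : DataSpace n) : ℝ := √(‖q.snd‖ ^ 2 - ‖q.fst‖ ^ 2)

theorem coneHeight_coneMap (z : ImageSpace n × sphere (0 : ImageSpace n) 1) :
    coneHeight (coneMap z) = |z.1.snd| := by
  rw [coneHeight, norm_coneMap_snd, coneMap_fst, norm_sq_imageSpace, add_sub_cancel_left,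
    Real.sqrt_sq_eq_abs]

/-- The map `(ξ, η) ↦ (ξ, √(‖η‖² - ‖ξ‖²))`. -/
def coneLift (q : DataSpace n) : ImageSpace n := WithLp.toLp 2 (q.fst, coneHeight q)

theorem continuous_coneHeight : Continuous (coneHeight (n := n)) := by
  unfold coneHeight
  have h1 : Continuous fun q : DataSpace n => q.snd := (WithLp.prod_continuous_ofLp 2 _ _).snd
  have h2 : Continuous fun q : DataSpace n => q.fst := (WithLp.prod_continuous_ofLp 2 _ _).fst
  fun_prop

theorem continuous_coneLift : Continuous (coneLift (n := n)) := by
  unfold coneLift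
  have h1 := continuous_coneHeight (n := n)
  have h2 : Continuous fun q : DataSpace n => q.fst := (WithLp.prod_continuous_ofLp 2 _ _).fst
  fun_prop

/-- `coneMap` forgets exactly the sign of the last coordinate of `ζ`, to which an even function is
blind. -/
theorem EvenInLast.apply_coneLift_coneMap {F : ImageSpace n → ℂ} (hF : EvenInLast F)
    (z : ImageSpace n × sphere (0 : ImageSpace n) 1) : F (coneLift (coneMap z)) = F z.1 := by
  rw [coneLift, coneHeight_coneMap, coneMap_fst, hF.abs_snd]
  rfl

/-! ### The explicit Fourier transform of the data -/

/-- The normalizing constant `(2π)^{n/2} / |Sⁿ|`. -/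
def dataConst (n : ℕ) : ℝ :=
  (sphereArea n)⁻¹ * fourierConst (ImageSpace n) * (fourierConst (DataSpace n))⁻¹

theorem dataConst_pos (n : ℕ) : 0 < dataConst n :=
  mul_pos (mul_pos (inv_pos.mpr (sphereArea_pos n)) (fourierConst_pos _))
    (inv_pos.mpr (fourierConst_pos _))

/-- The Fourier transform of the spherical mean of `f`. -/
def dataFourier (f : 𝓢(ImageSpace n, ℂ)) (q : DataSpace n) : ℂ :=
  (2 * coneWeight q) • ((dataConst n : ℂ) * unitaryFourierSchwartz f (coneLift q))

theorem measurable_dataFourier (f : 𝓢(ImageSpace n, ℂ)) : Measurable (dataFourier f) := by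
  have h1 : Continuous fun q : DataSpace n => unitaryFourierSchwartz f (coneLift q) :=
    (unitaryFourierSchwartz f).continuous.comp continuous_coneLift
  exact (measurable_coneWeight.const_mul 2).smul (h1.measurable.const_mul _)

theorem evenInLast_unitaryFourierSchwartz {f : 𝓢(ImageSpace n, ℂ)} (hf : EvenInLast f) :
    EvenInLast (unitaryFourierSchwartz f) := by
  rw [coe_unitaryFourierSchwartz]
  exact hf.unitaryFourier

theorem integrable_dataFourier {f : 𝓢(ImageSpace n, ℂ)} (hf : EvenInLast f) :
    Integrable (dataFourier f) := by
  have h1 : Continuous fun q : DataSpace n =>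
      (dataConst n : ℂ) * unitaryFourierSchwartz f (coneLift q) :=
    continuous_const.mul ((unitaryFourierSchwartz f).continuous.comp continuous_coneLift)
  refine (integrable_coneWeight_smul_iff h1.stronglyMeasurable).mpr ?_
  simp only [(evenInLast_unitaryFourierSchwartz hf).apply_coneLift_coneMap]
  exact (integrable_fst_coneMeasure (unitaryFourierSchwartz f).integrable).const_mul _

theorem isDistributionalFourier_dataFourier {f : 𝓢(ImageSpace n, ℂ)} (hf : EvenInLast f) :
    IsDistributionalFourier (sphericalMean f) (dataFourier f) := fun φ => by
  have h1 : Continuous fun q : DataSpace n =>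
      (dataConst n : ℂ) * unitaryFourierSchwartz f (coneLift q) * φ q :=
    (continuous_const.mul
      ((unitaryFourierSchwartz f).continuous.comp continuous_coneLift)).mul φ.continuous
  simp only [dataFourier, smul_mul_assoc]
  rw [integral_coneWeight_smul h1.stronglyMeasurable, integral_sphericalMean_mul_unitaryFourier]
  simp only [(evenInLast_unitaryFourierSchwartz hf).apply_coneLift_coneMap, mul_assoc,
    integral_const_mul]
  rw [dataConst, mul_assoc]

/-! ### The filter and the inversion formula -/

theorem coneWeight_eq (q : DataSpace n) :
    coneWeight q = ‖q.snd‖ / (‖q.snd‖ ^ n * coneHeight q) := rfl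

/-- The filter cancels `coneWeight` on the open cone, and its root vanishes elsewhere. With `1 ≤ n`
the truncated exponent `n - 1` is the true one. -/
theorem filterK_dataFourier (hn : 1 ≤ n) (f : 𝓢(ImageSpace n, ℂ)) (q : DataSpace n) :
    filterK (dataFourier f) q = {q : DataSpace n | ‖q.fst‖ < ‖q.snd‖}.indicator
      (fun q => 2 * (dataConst n : ℂ) * unitaryFourierSchwartz f (coneLift q)) q := by
  obtain ⟨m, rfl⟩ := Nat.exists_eq_add_of_le' hn
  rw [filterK, dataFourier, Complex.real_smul]
  by_cases hq : ‖q.fst‖ < ‖q.snd‖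
  · rw [Set.indicator_of_mem (by exact hq)]
    have h0 : 0 < ‖q.snd‖ := (norm_nonneg _).trans_lt hq
    have h1 : 0 < √(‖q.snd‖ ^ 2 - ‖q.fst‖ ^ 2) :=
      Real.sqrt_pos.mpr (by nlinarith [norm_nonneg q.fst])
    have h2 : √(‖q.snd‖ ^ 2 - ‖q.fst‖ ^ 2) * ‖q.snd‖ ^ (m + 1 - 1) * (2 * coneWeight q) = 2 := by
      rw [coneWeight, Nat.add_sub_cancel]
      field_simp
      exact (pow_succ' _ _).symm
    rw [← mul_assoc, ← Complex.ofReal_mul, h2]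
    push_cast
    ring
  · rw [Set.indicator_of_notMem (by exact hq), Real.sqrt_eq_zero_of_nonpos]
    · simp
    · nlinarith [not_lt.mp hq, norm_nonneg q.snd]

theorem measurable_filterK {G : DataSpace n → ℂ} (hG : Measurable G) :
    Measurable (filterK G) := by
  have h1 : Measurable fun q : DataSpace n => q.snd :=
    (WithLp.prod_continuous_ofLp 2 _ _).snd.measurable
  have h2 : Measurable fun q : DataSpace n => q.fst :=
    (WithLp.prod_continuous_ofLp 2 _ _).fst.measurable
  unfold filterK
  fun_prop

/-- On the cone `‖coneLift q‖ = ‖η‖` is comparable to `‖q‖`, so the Schwartz decay of `f̂` passes to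
its lift. -/
theorem exists_norm_filterK_dataFourier_le (hn : 1 ≤ n) (f : 𝓢(ImageSpace n, ℂ)) (k : ℕ) :
    ∃ M : ℝ, 0 ≤ M ∧ ∀ q, (1 + ‖q‖) ^ k * ‖filterK (dataFourier f) q‖ ≤ M := by
  set F := unitaryFourierSchwartz f with hF
  obtain ⟨M, hM⟩ : ∃ M : ℝ, ∀ v, (1 + ‖v‖) ^ k * ‖F v‖ ≤ M := by
    have := SchwartzMap.one_add_le_sup_seminorm_apply (𝕜 := ℝ) (m := (k, 0)) le_rfl le_rfl F
    simp only [norm_iteratedFDeriv_zero] at this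
    exact ⟨_, this⟩
  have hM0 : 0 ≤ M := le_trans (by positivity) (hM 0)
  have hc := dataConst_pos n
  refine ⟨2 ^ k * (2 * dataConst n * M), by positivity, fun q => ?_⟩
  rw [filterK_dataFourier hn]
  by_cases hq : ‖q.fst‖ < ‖q.snd‖
  · rw [Set.indicator_of_mem (by exact hq), norm_mul, norm_mul, Complex.norm_real,
      Real.norm_of_nonneg hc.le, Complex.norm_ofNat]
    have h1 : ‖coneLift q‖ = ‖q.snd‖ := by
      rw [← sq_eq_sq₀ (norm_nonneg _) (norm_nonneg _), norm_sq_imageSpace]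
      change ‖q.fst‖ ^ 2 + √(‖q.snd‖ ^ 2 - ‖q.fst‖ ^ 2) ^ 2 = _
      rw [Real.sq_sqrt (by nlinarith [norm_nonneg q.fst])]
      ring
    have h2 : ‖q‖ ≤ 2 * ‖q.snd‖ := by
      rw [← sq_le_sq₀ (norm_nonneg _) (by positivity), WithLp.prod_norm_sq_eq_of_L2]
      nlinarith [norm_nonneg q.fst]
    have h3 : (1 + ‖q‖) ^ k ≤ 2 ^ k * (1 + ‖coneLift q‖) ^ k := by
      rw [← mul_pow, h1]
      gcongr
      linarith
    calc (1 + ‖q‖) ^ k * (2 * dataConst n * ‖F (coneLift q)‖)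
        ≤ 2 ^ k * (1 + ‖coneLift q‖) ^ k * (2 * dataConst n * ‖F (coneLift q)‖) := by gcongr
      _ = 2 ^ k * (2 * dataConst n * ((1 + ‖coneLift q‖) ^ k * ‖F (coneLift q)‖)) := by ring
      _ ≤ _ := by gcongr; exact hM _
  · rw [Set.indicator_of_notMem (by exact hq), norm_zero, mul_zero]
    positivity

/-- A rapidly decreasing measurable function lies in every `Lᵖ`. -/
theorem memLp_of_rapid_decay {E : Type*} [NormedAddCommGroup E] [NormedSpace ℝ E]
    [MeasurableSpace E] [BorelSpace E] [FiniteDimensional ℝ E] {μ : Measure E}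
    [μ.IsAddHaarMeasure] {K : E → ℂ} (hK : Measurable K)
    (h : ∀ k : ℕ, ∃ M : ℝ, 0 ≤ M ∧ ∀ q, (1 + ‖q‖) ^ k * ‖K q‖ ≤ M) {p : ℝ≥0∞} (hp : 0 < p) :
    MemLp K p μ := by
  rcases eq_or_ne p ⊤ with rfl | hpt
  · obtain ⟨M, -, hM⟩ := h 0
    exact memLp_top_of_bound hK.aestronglyMeasurable M (.of_forall fun q => by simpa using hM q)
  · have hp0 : 0 < p.toReal := ENNReal.toReal_pos hp.ne' hpt
    -- Decay of order `k` makes the `p`-th power integrable as soon as `k * p` exceeds the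
    -- dimension.
    obtain ⟨k, hk⟩ := exists_nat_gt ((Module.finrank ℝ E : ℝ) / p.toReal)
    rw [div_lt_iff₀ hp0] at hk
    obtain ⟨M, hM0, hM⟩ := h k
    rw [← integrable_norm_rpow_iff hK.aestronglyMeasurable hp.ne' hpt]
    refine ((integrable_one_add_norm (μ := μ) hk).const_mul (M ^ p.toReal)).mono'
      (hK.norm.pow_const _).aestronglyMeasurable (.of_forall fun q => ?_)
    have h1 : 0 < 1 + ‖q‖ := by positivity
    have h2 : ‖K q‖ ≤ M * (1 + ‖q‖) ^ (-(k : ℝ)) := by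
      rw [Real.rpow_neg h1.le, Real.rpow_natCast, ← div_eq_mul_inv, le_div_iff₀ (by positivity),
        mul_comm]
      exact hM q
    rw [Real.norm_of_nonneg (by positivity)]
    calc ‖K q‖ ^ p.toReal ≤ (M * (1 + ‖q‖) ^ (-(k : ℝ))) ^ p.toReal := by gcongr
      _ = _ := by
        rw [Real.mul_rpow hM0 (by positivity), ← Real.rpow_mul h1.le, neg_mul]

theorem memLp_filterK_dataFourier (hn : 1 ≤ n) (f : 𝓢(ImageSpace n, ℂ)) {p : ℝ≥0∞}
    (hp : 0 < p) : MemLp (filterK (dataFourier f)) p volume :=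
  memLp_of_rapid_decay (measurable_filterK (measurable_dataFourier f))
    (exists_norm_filterK_dataFourier_le hn f) hp

theorem coneWeight_neg (q : DataSpace n) : coneWeight (-q) = coneWeight q := by
  simp [coneWeight]

theorem coneLift_neg (q : DataSpace n) : coneLift (-q) = flipLast n (-coneLift q) := by
  have h : coneHeight (-q) = coneHeight q := by simp [coneHeight]
  apply (WithLp.equiv 2 _).injective
  exact Prod.ext rfl (h.trans (neg_neg (coneHeight q)).symm)

theorem inversionConst_mul (n : ℕ) :
    inversionConst n * (2 * dataConst n ^ 2 * sphereArea n) = 1 := by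
  have hS := (sphereArea_pos n).ne'
  have hI := fourierConst_sq (ImageSpace n)
  have hD := fourierConst_sq (DataSpace n)
  rw [finrank_imageSpace] at hI
  rw [finrank_dataSpace] at hD
  rw [inversionConst, dataConst, mul_pow ((sphereArea n)⁻¹ * fourierConst (ImageSpace n)),
    mul_pow (sphereArea n)⁻¹, inv_pow (sphereArea n), inv_pow (fourierConst _), hI, hD, inv_inv]
  change 1 / (2 * Real.pi) ^ n * (sphereArea n / 2) * _ = 1
  field_simp
  ring

theorem coneWeight_eq_zero {q : DataSpace n} (hq : ¬ ‖q.fst‖ < ‖q.snd‖) : coneWeight q = 0 := by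
  rw [coneWeight, Real.sqrt_eq_zero_of_nonpos (by nlinarith [not_lt.mp hq, norm_nonneg q.snd]),
    mul_zero, div_zero]

theorem integral_filterK_mul_dataFourier_neg (hn : 1 ≤ n) {f φ : 𝓢(ImageSpace n, ℂ)}
    (hf : EvenInLast f) (hφ : EvenInLast φ) :
    ∫ q, filterK (dataFourier f) q * dataFourier φ (-q) =
      ((2 * dataConst n ^ 2 * sphereArea n : ℝ) : ℂ) * ∫ v, f v * φ v := by
  set F := unitaryFourierSchwartz f
  set P := unitaryFourierSchwartz φ
  have hF : EvenInLast F := evenInLast_unitaryFourierSchwartz hf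
  have hP : EvenInLast P := evenInLast_unitaryFourierSchwartz hφ
  -- `coneLift (-q)` is `-coneLift q` up to the sign of the last coordinate, so the second factor
  -- becomes the lift of this even function.
  have hPneg : EvenInLast fun v => P (-v) := fun x y => hP (-x) (-y)
  have h1 : ∀ q : DataSpace n, filterK (dataFourier f) q * dataFourier φ (-q) =
      (2 * coneWeight q) • (((2 * dataConst n ^ 2 : ℝ) : ℂ) *
        (F (coneLift q) * P (-coneLift q))) := fun q => by
    have h2 : P (flipLast n (-coneLift q)) = P (-coneLift q) :=
      congrFun hP.comp_flipLast (-coneLift q)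
    rw [filterK_dataFourier hn, dataFourier, coneWeight_neg, coneLift_neg]
    by_cases hq : ‖q.fst‖ < ‖q.snd‖
    · rw [Set.indicator_of_mem (by exact hq), h2, mul_smul_comm]
      congr 1
      push_cast
      ring
    · rw [coneWeight_eq_zero hq]
      simp
  have hc : Continuous fun q : DataSpace n => ((2 * dataConst n ^ 2 : ℝ) : ℂ) *
        (F (coneLift q) * P (-coneLift q)) :=
    continuous_const.mul ((F.continuous.comp continuous_coneLift).mul
      (P.continuous.comp continuous_coneLift.neg))
  simp_rw [h1]
  rw [integral_coneWeight_smul hc.stronglyMeasurable]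
  simp only [hF.apply_coneLift_coneMap, hPneg.apply_coneLift_coneMap]
  rw [integral_const_mul, integral_fun_fst (fun v => F v * P (-v)),
    integral_mul_eq_integral_unitaryFourier f φ, Complex.real_smul, ← mul_assoc,
    ← Complex.ofReal_mul]
  rfl

/-- Any integrable representative `H` agrees almost everywhere with `dataFourier φ`, which reduces
the claim to the explicit formula. Absolute convergence holds because the filtered factor is
bounded. -/
theorem inversion_of_isDistributionalFourier (hn : 1 ≤ n) {f φ : 𝓢(ImageSpace n, ℂ)}
    (hf : EvenInLast f) (hφ : EvenInLast φ) {H : DataSpace n → ℂ} (hH : Integrable H)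
    (hHF : IsDistributionalFourier (sphericalMean φ) H) :
    Integrable (fun q => filterK (dataFourier f) q * H (-q)) volume ∧
      ∫ v, f v * φ v = (inversionConst n : ℂ) * ∫ q, filterK (dataFourier f) q * H (-q) := by
  obtain ⟨M, -, hM⟩ := exists_norm_filterK_dataFourier_le hn f 0
  have hmp := (LinearIsometryEquiv.neg ℝ (E := DataSpace n)).measurePreserving
  have hHneg : Integrable fun q => H (-q) := hmp.integrable_comp_of_integrable hH
  refine ⟨hHneg.bdd_mul (c := M)
    (measurable_filterK (measurable_dataFourier f)).aestronglyMeasurable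
    (.of_forall fun q => by simpa using hM q), ?_⟩
  have hae : H =ᵐ[volume] dataFourier φ :=
    ae_eq_of_integral_schwartz_eq hH.locallyIntegrable
      (integrable_dataFourier hφ).locallyIntegrable fun ψ =>
      (hHF ψ).trans (isDistributionalFourier_dataFourier hφ ψ).symm
  have hneg := hmp.quasiMeasurePreserving.ae_eq_comp hae
  have h1 : ∫ q, filterK (dataFourier f) q * H (-q) =
      ∫ q, filterK (dataFourier f) q * dataFourier φ (-q) := by
    refine integral_congr_ae ?_
    filter_upwards [hneg] with q hq
    rw [show H (-q) = dataFourier φ (-q) from hq]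
  rw [h1, integral_filterK_mul_dataFourier_neg hn hf hφ, ← mul_assoc, ← Complex.ofReal_mul,
    inversionConst_mul, Complex.ofReal_one, one_mul]

/-! ### Failure of square integrability -/

theorem coneWeight_coneMap (z : ImageSpace n × sphere (0 : ImageSpace n) 1) :
    coneWeight (coneMap z) = ‖z.1‖ / (‖z.1‖ ^ n * |z.1.snd|) := by
  rw [coneWeight_eq, norm_coneMap_snd, coneHeight_coneMap]

/-- Of the two weights in `‖ĝ‖²`, one is the density of the change of variables. The other survives,
and the integrand does not depend on `σ`, so the nonzero sphere factor can be dropped. -/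
theorem integrable_of_memLp_dataFourier {f : 𝓢(ImageSpace n, ℂ)} (hf : EvenInLast f)
    (h : MemLp (dataFourier f) 2 volume) :
    Integrable fun ζ : ImageSpace n =>
      ‖ζ‖ / (‖ζ‖ ^ n * |ζ.snd|) * ‖unitaryFourierSchwartz f ζ‖ ^ 2 := by
  set F := unitaryFourierSchwartz f
  have hF : EvenInLast F := evenInLast_unitaryFourierSchwartz hf
  have hFn : ∀ z, ‖F (coneLift (coneMap z))‖ = ‖F z.1‖ := fun z => by
    rw [hF.apply_coneLift_coneMap z]
  have h1 : StronglyMeasurable fun q : DataSpace n =>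
      2 * dataConst n ^ 2 * coneWeight q * ‖F (coneLift q)‖ ^ 2 := by
    have : Continuous fun q : DataSpace n => F (coneLift q) :=
      F.continuous.comp continuous_coneLift
    exact ((measurable_coneWeight.const_mul _).mul
      (this.norm.pow 2).measurable).stronglyMeasurable
  have h2 : Integrable fun q : DataSpace n => (2 * coneWeight q) •
      (2 * dataConst n ^ 2 * coneWeight q * ‖F (coneLift q)‖ ^ 2) := by
    refine ((memLp_two_iff_integrable_sq_norm h.1).mp h).congr (.of_forall fun q => ?_)
    simp only [dataFourier, norm_smul, norm_mul, mul_pow, Complex.norm_real, Real.norm_eq_abs,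
      sq_abs, smul_eq_mul]
    ring
  rw [integrable_coneWeight_smul_iff h1] at h2
  simp only [hFn, coneWeight_coneMap] at h2
  have : (surfaceMeasure n) ≠ 0 := Measure.toSphere_ne_zero volume
  have h3 := (Integrable.comp_fst_iff (f := fun ζ : ImageSpace n =>
    2 * dataConst n ^ 2 * (‖ζ‖ / (‖ζ‖ ^ n * |ζ.snd|)) * ‖F ζ‖ ^ 2) this).mp h2
  refine (h3.const_mul (2 * dataConst n ^ 2)⁻¹).congr (.of_forall fun ζ => ?_)
  have := (dataConst_pos n).ne'
  dsimp only
  field_simp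

/-- If `f̂(0) ≠ 0`, then `ĝ` is not square integrable. -/
theorem not_memLp_dataFourier (hn : 1 ≤ n) {f : 𝓢(ImageSpace n, ℂ)} (hf : EvenInLast f)
    (h0 : unitaryFourier f 0 ≠ 0) : ¬ MemLp (dataFourier f) 2 volume := fun h => by
  have h1 := integrable_of_memLp_dataFourier hf h
  rw [← coe_unitaryFourierSchwartz] at h0
  set F := unitaryFourierSchwartz f
  obtain ⟨δ, hδ, hδF⟩ : ∃ δ > 0, ∀ ζ : ImageSpace n, ‖ζ‖ < δ → ‖F 0‖ / 2 < ‖F ζ‖ := by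
    have := (F.continuous.norm.tendsto 0).eventually
      (lt_mem_nhds (half_lt_self (norm_pos_iff.mpr h0)))
    obtain ⟨δ, hδ, h⟩ := Metric.eventually_nhds_iff.mp this
    exact ⟨δ, hδ, fun ζ hζ => h (by simpa using hζ)⟩
  -- Points of the box below have norm less than `2 * r = min δ 1`, hence lie where `f̂` is bounded
  -- away from `0` and inside the unit ball.
  set r : ℝ := min δ 1 / 2 with hr
  have hr0 : 0 < r := by positivity
  have h2 := ((WithLp.volume_preserving_toLp (EuclideanSpace ℝ (Fin n))
    ℝ).integrable_comp_of_integrable h1).integrableOn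
      (s := ball (0 : EuclideanSpace ℝ (Fin n)) r ×ˢ Set.Ioo 0 r)
  have h3 : Integrable (fun p : EuclideanSpace ℝ (Fin n) × ℝ => p.2⁻¹)
      (volume.restrict (ball 0 r ×ˢ Set.Ioo 0 r)) := by
    refine (h2.const_mul ((‖F 0‖ / 2) ^ 2)⁻¹).mono'
      (measurable_snd.inv).aestronglyMeasurable ?_
    filter_upwards [ae_restrict_mem (measurableSet_ball.prod measurableSet_Ioo)]
      with ⟨x, t⟩ ⟨hx, ht⟩
    simp only [mem_ball_zero_iff, Set.mem_Ioo] at hx ht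
    set ζ : ImageSpace n := WithLp.toLp 2 (x, t)
    have hζ2 : ‖ζ‖ ^ 2 = ‖x‖ ^ 2 + t ^ 2 := norm_sq_imageSpace ζ
    have hζ : ‖ζ‖ < 2 * r := by
      rw [← sq_lt_sq₀ (norm_nonneg _) (by positivity), hζ2]
      nlinarith [norm_nonneg x]
    have hζ0 : 0 < ‖ζ‖ := by
      refine (sq_pos_iff.mp ?_).symm.lt_of_le (norm_nonneg ζ)
      rw [hζ2]
      nlinarith [sq_nonneg ‖x‖]
    have hζ1 : ‖ζ‖ ≤ 1 := by linarith [min_le_right δ 1]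
    have hFζ := hδF ζ (by linarith [min_le_left δ 1])
    have hF0 : 0 < ‖F 0‖ := norm_pos_iff.mpr h0
    rw [Real.norm_of_nonneg (inv_nonneg.mpr ht.1.le)]
    change t⁻¹ ≤ ((‖F 0‖ / 2) ^ 2)⁻¹ * (‖ζ‖ / (‖ζ‖ ^ n * |t|) * ‖F ζ‖ ^ 2)
    -- Here `1 ≤ n` enters: `‖ζ‖ ^ n ≤ ‖ζ‖` in the unit ball, so the weight dominates `t⁻¹`.
    have h4 : t⁻¹ ≤ ‖ζ‖ / (‖ζ‖ ^ n * |t|) := by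
      rw [abs_of_pos ht.1, le_div_iff₀ (mul_pos (pow_pos hζ0 n) ht.1), mul_comm (‖ζ‖ ^ n),
        inv_mul_cancel_left₀ ht.1.ne']
      exact pow_le_of_le_one hζ0.le hζ1 (by omega)
    have h5 : (‖F 0‖ / 2) ^ 2 ≤ ‖F ζ‖ ^ 2 := by gcongr
    calc t⁻¹ = ((‖F 0‖ / 2) ^ 2)⁻¹ * (t⁻¹ * (‖F 0‖ / 2) ^ 2) := by field_simp
      _ ≤ _ := by
        have := inv_pos.mpr ht.1
        gcongr
  rw [Measure.volume_eq_prod, ← Measure.prod_restrict] at h3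
  have hne : (volume : Measure (EuclideanSpace ℝ (Fin n))).restrict (ball 0 r) ≠ 0 := by
    rw [Ne, Measure.restrict_eq_zero]
    exact (measure_ball_pos volume _ hr0).ne'
  have hfin : IsFiniteMeasure
      ((volume : Measure (EuclideanSpace ℝ (Fin n))).restrict (ball 0 r)) :=
    ⟨by simpa using measure_ball_lt_top⟩
  -- The ball has positive measure, so integrability on the box would make `t⁻¹` integrable at `0`.
  have h4 : IntegrableOn (fun t : ℝ => t⁻¹) (Set.Ioo 0 r) :=
    (Integrable.comp_snd_iff (f := fun t : ℝ => t⁻¹) hne).mp h3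
  rw [← intervalIntegrable_iff_integrableOn_Ioo_of_le hr0.le, intervalIntegrable_inv_iff] at h4
  rcases h4 with h4 | h4
  · exact hr0.ne h4
  · exact h4 Set.left_mem_uIcc

/-- If `f̂(0) ≠ 0`, then `ĝ` is not represented by a square integrable function. -/
theorem not_exists_memLp_isDistributionalFourier (hn : 1 ≤ n) {f : 𝓢(ImageSpace n, ℂ)}
    (hf : EvenInLast f) (h0 : unitaryFourier f 0 ≠ 0) :
    ¬ ∃ G : DataSpace n → ℂ, MemLp G 2 volume ∧
      IsDistributionalFourier (sphericalMean f) G := by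
  rintro ⟨G, hG, hGF⟩
  have hae : G =ᵐ[volume] dataFourier f :=
    ae_eq_of_integral_schwartz_eq (hG.locallyIntegrable one_le_two)
      (integrable_dataFourier hf).locallyIntegrable fun ψ =>
      (hGF ψ).trans (isDistributionalFourier_dataFourier hf ψ).symm
  exact not_memLp_dataFourier hn hf h0 (hG.ae_eq hae)

end SphericalMean

end

theorem mainTheorem12 (n : ℕ) (hn : 1 ≤ n) :
    -- neither `g = Rf` nor `ĝ` is square integrable, and `g` is not a Schwartz function
    (∀ f ∈ testFunctionsEven n, unitaryFourier f 0 ≠ 0 →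
      ¬ MemLp (sphericalMean f) 2 volume ∧
      (¬ ∃ G : DataSpace n → ℂ, MemLp G 2 volume ∧
        IsDistributionalFourier (sphericalMean f) G) ∧
      ¬ ∃ φ : 𝓢(DataSpace n, ℂ), (φ : DataSpace n → ℂ) = sphericalMean f) ∧
    -- the Fourier transform of `Kg` lies in every `Lᵖ`, and `f = cₙ R* K g` holds weakly
    (∀ f ∈ schwartzEven n,
      ∃ G : DataSpace n → ℂ, Integrable G volume ∧
        IsDistributionalFourier (sphericalMean f) G ∧
        (∀ p : ℝ≥0∞, 0 < p → MemLp (filterK G) p volume) ∧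
        ∀ φ ∈ schwartzEven n, ∀ H : DataSpace n → ℂ, Integrable H volume →
          IsDistributionalFourier (sphericalMean φ) H →
          Integrable (fun q => filterK G q * H (-q)) volume ∧
          ∫ v, f v * φ v = (inversionConst n : ℂ) * ∫ q, filterK G q * H (-q)) := by
  refine ⟨fun f hf h0 => ?_, fun f hf => ?_⟩
  · obtain ⟨hsm, hcs, hev⟩ := hf
    let f' : 𝓢(ImageSpace n, ℂ) := hcs.toSchwartzMap hsm
    have hdist := not_exists_memLp_isDistributionalFourier hn (f := f') hev h0
    have hL2 : ¬ MemLp (sphericalMean f) 2 volume := fun h =>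
      hdist (exists_memLp_isDistributionalFourier h)
    exact ⟨hL2, hdist, fun ⟨φ, hφ⟩ => hL2 (hφ ▸ φ.memLp 2)⟩
  · exact ⟨dataFourier f, integrable_dataFourier hf, isDistributionalFourier_dataFourier hf,
      fun p hp => memLp_filterK_dataFourier hn f hp, fun φ hφ H hH hHF =>
      inversion_of_isDistributionalFourier hn hf hφ hH hHF⟩
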